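/- A function $F:[0,1]\to\mathbb R$ is AC on a set $E\subseteq[0,1]$ if for every $\varepsilon>0$ there is $\delta>0$ such that $\sum_i|F(d_i)-F(c_i)|<\varepsilon$ for every finite family of non-overlapping intervals $[c_i,d_i]$ with endpoints in $E$ and $\sum_i(d_i-c_i)<\delta$; $F$ is ACG on $[0,1]$ if it is continuous on $[0,1]$ and $[0,1]$ is a countable union of sets on each of which $F$ is AC. $F$ has approximate derivative $v$ at $x$ if there is a Lebesgue measurable set $E$ having $x$ as a point of density such that $\frac{F(y)-F(x)}{y-x}\to v$ as $y\to x$, $y\in E\setminus\{x\}$. A function $f:[0,1]\to\mathbb R$ is Denjoy–Khintchine integrable if there is an ACG function $F$ on $[0,1]$ whose approximate derivative equals $f$ almost everywhere; its indefinite integral is then the interval function $\Phi([c,d])=F(d)-F(c)$, $0\le c\le d\le 1$. The interval variation of $\Phi$ is $$\widetilde\Phi([0,1])=\sup\Big\{\sum_{i=1}^n|\Phi(I_i)| : \{I_1,\dots,I_n\}\text{ is a finite partition of }[0,1]\text{ into non-overlapping closed intervals}\Big\}.$$ **Lemma.** Let $f:[0,1]\to\mathbb R$ be Denjoy–Khintchine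 integrable with indefinite integral $\Phi$. If $\widetilde\Phi([0,1])<\infty$, then $f$ is Lebesgue integrable on $[0,1]$. -/

import Mathlib

open MeasureTheory Set Filter Topology
open scoped ENNReal

/-- `F` is absolutely continuous (AC) on the set `E ⊆ ℝ`: for every `ε > 0` there is `δ > 0` such
that `∑ |F (d i) - F (c i)| < ε` for every finite family of non-overlapping closed intervals
`[c i, d i]` with endpoints in `E` and total length less than `δ`. -/
def IsACOn (F : ℝ → ℝ) (E : Set ℝ) : Prop :=
  ∀ ε : ℝ, 0 < ε → ∃ δ : ℝ, 0 < δ ∧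
    ∀ (n : ℕ) (c d : Fin n → ℝ),
      (∀ i, c i ∈ E ∧ d i ∈ E ∧ c i ≤ d i) →
      (∀ i j, i ≠ j → Disjoint (Ioo (c i) (d i)) (Ioo (c j) (d j))) →
      ∑ i, (d i - c i) < δ →
      ∑ i, |F (d i) - F (c i)| < ε

/-- `F` is generalized absolutely continuous (ACG) on `E`: the restriction of `F` to `E` is
continuous and `E` is a countable union of sets on each of which `F` is AC. -/
def IsACGOn (F : ℝ → ℝ) (E : Set ℝ) : Prop :=
  ContinuousOn F E ∧ ∃ A : ℕ → Set ℝ, (⋃ n, A n) = E ∧ ∀ n, IsACOn F (A n)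

/-- `c` is a point of (Lebesgue) density of the set `E`. -/
def IsDensityPoint (E : Set ℝ) (c : ℝ) : Prop :=
  Tendsto (fun h : ℝ => volume (E ∩ Metric.closedBall c h) / volume (Metric.closedBall c h))
    (𝓝[>] 0) (𝓝 1)

/-- `F` has approximate derivative `v` at `c`: there is a Lebesgue measurable set `E` that has `c`
as a point of density and along which `F` has derivative `v` at `c`. -/
def HasApproxDerivAt (F : ℝ → ℝ) (v : ℝ) (c : ℝ) : Prop :=
  ∃ E : Set ℝ, NullMeasurableSet E volume ∧ IsDensityPoint E c ∧ HasDerivWithinAt F v E c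

/-- `F` is a Denjoy–Khintchine primitive of `f` on `[0,1]`: `F` is ACG on `[0,1]` and its
approximate derivative is equal to `f` almost everywhere on `[0,1]`. -/
def IsDKPrimitive (f F : ℝ → ℝ) : Prop :=
  IsACGOn F (Icc 0 1) ∧ ∀ᵐ x ∂(volume.restrict (Icc (0 : ℝ) 1)), HasApproxDerivAt F (f x) x

/-- `f` is Denjoy–Khintchine integrable on `[0,1]`. -/
def DKIntegrable (f : ℝ → ℝ) : Prop :=
  ∃ F : ℝ → ℝ, IsDKPrimitive f F

/-- The interval function `Φ` is the indefinite Denjoy–Khintchine integral of `f` on `[0,1]`: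
`Φ [c,d] = (DK) ∫_c^d f = F d - F c` for all closed subintervals `[c,d]` of `[0,1]`, where `F` is a
Denjoy–Khintchine primitive of `f`. Values of `Φ` on other sets are irrelevant. -/
def IsDKIntegral (f : ℝ → ℝ) (Φ : Set ℝ → ℝ) : Prop :=
  ∃ F : ℝ → ℝ, IsDKPrimitive f F ∧
    ∀ c d : ℝ, 0 ≤ c → c ≤ d → d ≤ 1 → Φ (Icc c d) = F d - F c

/-- The interval variation over `[0,1]` of an interval function `Φ`: the supremum of
`∑ |Φ [t i, t (i+1)]|` over all finite partitions `0 = t 0 < t 1 < ... < t n = 1` of `[0,1]` into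
closed intervals. -/
noncomputable def intervalVariation (Φ : Set ℝ → ℝ) : ℝ≥0∞ :=
  ⨆ (n : ℕ) (t : Fin (n + 1) → ℝ) (_ : StrictMono t ∧ t 0 = 0 ∧ t (Fin.last n) = 1),
    ∑ i : Fin n, ‖Φ (Icc (t i.castSucc) (t i.succ))‖ₑ

/-! Finite interval variation of `Φ` says that the primitive `F` has bounded variation on [0,1]. By
Lebesgue's theorem `F` is then differentiable a.e. with integrable derivative. Where `F` is
differentiable, its approximate derivative is the ordinary one, so `f = deriv F` a.e. -/

/-- A finite monotone sequence can be thinned out to a strictly increasing one with the same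
endpoints, along which every function has the same variation sum. -/
theorem Monotone.exists_strictMonoOn_sum_edist_eq {α E : Type*} [LinearOrder α]
    [PseudoEMetricSpace E] (f : α → E) {u : ℕ → α} (hu : Monotone u) (n : ℕ) :
    ∃ (m : ℕ) (v : ℕ → α), StrictMonoOn v (Iic m) ∧ v 0 = u 0 ∧ v m = u n ∧
      ∑ i ∈ Finset.range n, edist (f (u (i + 1))) (f (u i)) =
        ∑ i ∈ Finset.range m, edist (f (v (i + 1))) (f (v i)) := by
  induction n with
  | zero => exact ⟨0, u, by grind [StrictMonoOn], rfl, rfl, rfl⟩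
  | succ n ih =>
    obtain ⟨m, v, hv, h0, hm, hsum⟩ := ih
    rcases (hu (Nat.le_add_right n 1)).eq_or_lt with hn | hn
    · exact ⟨m, v, hv, h0, hm.trans hn, by simp [Finset.sum_range_succ, ← hn, hsum]⟩
    · refine ⟨m + 1, fun i ↦ if i ≤ m then v i else u (n + 1), by grind [StrictMonoOn],
        by simpa using h0, by simp, ?_⟩
      simp only [hsum, ← hm, Order.add_one_le_iff, Finset.sum_range_succ, lt_self_iff_false,
        ↓reduceIte, le_refl]
      congr 1
      exact Finset.sum_congr rfl (by grind)

/-- `eVariationOn` allows repeated points and sequences that miss 0 or 1. Adding the endpoints only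
increases the sum, and thinning out repetitions preserves it. -/
theorem eVariationOn_le_intervalVariation {F : ℝ → ℝ} {Φ : Set ℝ → ℝ}
    (hΦ : ∀ c d : ℝ, 0 ≤ c → c ≤ d → d ≤ 1 → Φ (Icc c d) = F d - F c) :
    eVariationOn F (Icc 0 1) ≤ intervalVariation Φ := by
  refine iSup_le ?_
  rintro ⟨n, u, hu, hmem⟩
  -- The points `u 0, …, u n` occupy indices 1 to `n + 1`, between the added 0 and 1.
  let w : ℕ → ℝ := fun i ↦ if i = 0 then 0 else if i ≤ n + 1 then u (i - 1) else 1
  have hw : Monotone w := by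
    refine monotone_nat_of_le_succ fun i ↦ ?_
    have h1 := (hmem i).1
    have h2 := (hmem (i - 1)).2
    have h3 : u (i - 1) ≤ u i := hu (Nat.sub_le i 1)
    simp only [w]
    split_ifs <;> first | omega | simp_all
  obtain ⟨m, v, hv, h0, hm, hsum⟩ := hw.exists_strictMonoOn_sum_edist_eq F (n + 2)
  have hv0 : v 0 = 0 := by simpa [w] using h0
  have hv1 : v m = 1 := by simpa [w] using hm
  calc ∑ i ∈ Finset.range n, edist (F (u (i + 1))) (F (u i))
      = ∑ i ∈ Finset.range n, edist (F (w (i + 1 + 1))) (F (w (i + 1))) :=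
        Finset.sum_congr rfl fun i hi ↦ by
          have := Finset.mem_range.1 hi
          simp [w, this, this.le]
    _ ≤ ∑ i ∈ Finset.range (n + 2), edist (F (w (i + 1))) (F (w i)) := by
        rw [Finset.sum_range_succ', Finset.sum_range_succ, add_assoc]
        exact le_self_add
    _ = ∑ i : Fin m, ‖Φ (Icc (v i) (v (i + 1)))‖ₑ := by
        rw [hsum, Finset.sum_range]
        refine Finset.sum_congr rfl fun i _ ↦ ?_
        have hi : (i : ℕ) ∈ Iic m := i.2.le
        have hi' : (i : ℕ) + 1 ∈ Iic m := i.2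
        rw [hΦ _ _ (hv0 ▸ hv.monotoneOn (Nat.zero_le m) hi (Nat.zero_le _))
          (hv.monotoneOn hi hi' (Nat.le_succ _))
          (hv1 ▸ hv.monotoneOn hi' (mem_Iic.2 le_rfl) hi'), edist_eq_enorm_sub]
    _ ≤ intervalVariation Φ := by
        refine le_iSup_of_le m (le_iSup_of_le (fun i ↦ v i) (le_iSup_of_le ⟨?_, ?_, ?_⟩ ?_))
        · exact fun i j hij ↦ hv (Nat.lt_succ_iff.1 i.2) (Nat.lt_succ_iff.1 j.2) hij
        · simpa using hv0
        · simpa using hv1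
        · simp

/-- Otherwise `E` meets small balls around `c` in a null set, at most `{c}`, and the density would
be 0. -/
theorem IsDensityPoint.accPt {E : Set ℝ} {c : ℝ} (h : IsDensityPoint E c) : AccPt c (𝓟 E) := by
  rw [accPt_iff_frequently]
  intro hn
  obtain ⟨r, hr, hball⟩ := Metric.eventually_nhds_iff.1 hn
  have hzero : ∀ᶠ s in 𝓝[>] (0 : ℝ),
      volume (E ∩ Metric.closedBall c s) / volume (Metric.closedBall c s) = 0 := by
    filter_upwards [Ioo_mem_nhdsGT hr] with s hs
    have hsub : E ∩ Metric.closedBall c s ⊆ {c} := by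
      intro y hy
      by_contra hne
      exact hball ((Metric.mem_closedBall.1 hy.2).trans_lt hs.2) ⟨hne, hy.1⟩
    rw [measure_mono_null hsub (measure_singleton c), ENNReal.zero_div]
  exact zero_ne_one (tendsto_nhds_unique (tendsto_const_nhds.congr' (hzero.mono fun _ h ↦ h.symm)) h)

/-- The approximate derivative agrees with the derivative where the latter exists. -/
theorem HasApproxDerivAt.deriv_eq {F : ℝ → ℝ} {v c : ℝ} (h : HasApproxDerivAt F v c)
    (hF : DifferentiableAt ℝ F c) : deriv F c = v := by
  obtain ⟨E, -, hE, hv⟩ := h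
  -- On the line, accumulation of `E` at `c` suffices for uniqueness of the derivative within `E`.
  exact hE.accPt.uniqueDiffWithinAt.eq_deriv _ hF.hasDerivAt.hasDerivWithinAt hv

theorem mainTheorem12 (f : ℝ → ℝ) (hf : DKIntegrable f)
    (Φ : Set ℝ → ℝ) (hΦ : IsDKIntegral f Φ) (hvar : intervalVariation Φ < ⊤) :
    IntegrableOn f (Icc (0 : ℝ) 1) volume := by
  obtain ⟨F, ⟨-, hder⟩, hF⟩ := hΦ
  have hbv : BoundedVariationOn F (uIcc 0 1) := by
    rw [uIcc_of_le zero_le_one]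
    exact ((eVariationOn_le_intervalVariation hF).trans_lt hvar).ne
  have hint : IntegrableOn (deriv F) (Icc 0 1) volume :=
    (intervalIntegrable_iff_integrableOn_Icc_of_le zero_le_one).1 hbv.intervalIntegrable_deriv
  refine hint.congr ?_
  have hdiff := hbv.ae_differentiableAt_of_mem_uIcc
  rw [uIcc_of_le zero_le_one, ← ae_restrict_iff' measurableSet_Icc] at hdiff
  filter_upwards [hder, hdiff] with x hx hx'
  exact hx.deriv_eq hx'
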